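/- Let $E_\rho$ be a universally complete Archimedean real vector lattice (Dedekind complete, and every nonempty set of pairwise disjoint positive elements has a supremum), equipped with an $f$-algebra multiplication with multiplicative identity $e$. Let $E=E_\rho\oplus iE_\rho$ be its complexification, with the canonically extended multiplication and the modulus $|f+ig|=\sup\{(\cos\theta)f+(\sin\theta)g:\theta\in[0,2\pi]\}$. A sequence $(x_n)_{n\ge0}$ in $E$ converges in order to $x\in E$, written $x_n\to x$, if there is a decreasing sequence $(p_n)_{n\ge0}$ in $E_\rho$ with $\inf_n p_n=0$ (written $p_n\downarrow0$) and $|x_n-x|\le p_n$ for all $n\ge0$. A series converges in order to $s$ if its partial sums do. For $x,y\in E_\rho$ write $x\ll y$ if $(y-x)^+$ is a weak order unit of $E_\rho$. For a power series $S(z)=\sum_{n=0}^\infty a_nz^n$ with $a_n\in E$ (where $z^0=e$), let $\Omega_S$ be the set of all $r\in E_\rho$, $r\ge0$, such that $S$ converges uniformly in order on $\{z\in E:|z|\le r\}$, i.e. there is a sequence $p_m\downarrow0$ with $\bigl|\sum_{n=0}^m a_nz^n-S(z)\bigr|\le p_m$ for all $m\ge0$ and all $z\in E$ with $|z|\le r$.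 If $\Omega_S$ is order bounded, $\sup\Omega_S$ is the radius of convergence of $S$. **Theorem (Abel).** Let $S(z)=\sum_{n=0}^\infty a_nz^n$ be a power series on $E$ with radius of convergence $e$, and suppose that $\sum_{n=0}^\infty a_n$ converges in order. Let $(z_k)_{k\ge0}$ be a sequence in $E$ such that 1. $z_k\to e$ in order, 2. $|z_k|\ll e$ for every $k\ge0$ (so that $e-|z_k|$ is invertible), and 3. the set $\{|e-z_k|\,(e-|z_k|)^{-1}:k\ge0\}$ is order bounded. Then $S(z_k)=\sum_{n=0}^\infty a_nz_k^n$ converges in order for every $k\ge0$, the series $S(e)=\sum_{n=0}^\infty a_ne^n$ converges in order, and $S(z_k)\to S(e)$ in order as $k\to\infty$. -/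

import Mathlib

/-- A universally complete Archimedean (real) `Φ`-algebra `A`.  The Dedekind completeness of `A`
(which implies that `A` is Archimedean) is carried by `ConditionallyCompleteLattice A`: every
nonempty set bounded above has a supremum, every nonempty set bounded below an infimum.
The fields say that `A` is an ordered vector space (hence, being a lattice, a vector lattice),
that its associative multiplication with identity `1` is an `f`-algebra multiplication, and that
`A` is laterally complete, i.e. every nonempty set of pairwise disjoint positive elements has a
supremum. Commutativity of the multiplication is not part of the definition. -/
class UnivCompletePhiAlgebra (A : Type*) [ConditionallyCompleteLattice A] [Ring A]
    [Algebra ℝ A] : Prop where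
  add_le_add_left' : ∀ x y : A, x ≤ y → ∀ z : A, z + x ≤ z + y
  smul_nonneg' : ∀ (t : ℝ) (x : A), 0 ≤ t → 0 ≤ x → 0 ≤ t • x
  mul_nonneg' : ∀ x y : A, 0 ≤ x → 0 ≤ y → 0 ≤ x * y
  mul_left_disjoint : ∀ x y w : A, 0 ≤ w → x ⊓ y = 0 → (w * x) ⊓ y = 0
  mul_right_disjoint : ∀ x y w : A, 0 ≤ w → x ⊓ y = 0 → (x * w) ⊓ y = 0
  laterally_complete : ∀ s : Set A, s.Nonempty → (∀ x ∈ s, 0 ≤ x) →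
    (∀ x ∈ s, ∀ y ∈ s, x ≠ y → x ⊓ y = 0) → ∃ b : A, IsLUB s b

/-- The vector space complexification `A ⊕ iA`; `⟨f, g⟩` is `f + ig`. -/
@[ext]
structure VLComplexification (A : Type*) where
  re : A
  im : A

namespace VLComplexification

section Algebraic

variable {A : Type*} [Ring A]

instance : Zero (VLComplexification A) := ⟨⟨0, 0⟩⟩
instance : One (VLComplexification A) := ⟨⟨1, 0⟩⟩
instance : Add (VLComplexification A) := ⟨fun z w => ⟨z.re + w.re, z.im + w.im⟩⟩
instance : Neg (VLComplexification A) := ⟨fun z => ⟨-z.re, -z.im⟩⟩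
/-- The canonical extension of the multiplication: `(a + ib)(c + id) = (ac - bd) + i(ad + bc)`. -/
instance : Mul (VLComplexification A) :=
  ⟨fun z w => ⟨z.re * w.re - z.im * w.im, z.re * w.im + z.im * w.re⟩⟩

@[simp] theorem zero_re : (0 : VLComplexification A).re = 0 := rfl
@[simp] theorem zero_im : (0 : VLComplexification A).im = 0 := rfl
@[simp] theorem one_re : (1 : VLComplexification A).re = 1 := rfl
@[simp] theorem one_im : (1 : VLComplexification A).im = 0 := rfl
@[simp] theorem add_re (z w : VLComplexification A) : (z + w).re = z.re + w.re := rfl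
@[simp] theorem add_im (z w : VLComplexification A) : (z + w).im = z.im + w.im := rfl
@[simp] theorem neg_re (z : VLComplexification A) : (-z).re = -z.re := rfl
@[simp] theorem neg_im (z : VLComplexification A) : (-z).im = -z.im := rfl
@[simp] theorem mul_re (z w : VLComplexification A) :
    (z * w).re = z.re * w.re - z.im * w.im := rfl
@[simp] theorem mul_im (z w : VLComplexification A) :
    (z * w).im = z.re * w.im + z.im * w.re := rfl

instance : Ring (VLComplexification A) where
  add_assoc x y z := by ext <;> simp [add_assoc]
  zero_add x := by ext <;> simp
  add_zero x := by ext <;> simp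
  add_comm x y := by ext <;> simp [add_comm]
  neg_add_cancel x := by ext <;> simp
  mul_assoc x y z := by ext <;> simp <;> noncomm_ring
  one_mul x := by ext <;> simp
  mul_one x := by ext <;> simp
  zero_mul x := by ext <;> simp
  mul_zero x := by ext <;> simp
  left_distrib x y z := by ext <;> simp <;> noncomm_ring
  right_distrib x y z := by ext <;> simp <;> noncomm_ring
  nsmul := nsmulRec
  zsmul := zsmulRec

@[simp] theorem sub_re (z w : VLComplexification A) : (z - w).re = z.re - w.re := by
  simp [sub_eq_add_neg]
@[simp] theorem sub_im (z w : VLComplexification A) : (z - w).im = z.im - w.im := by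
  simp [sub_eq_add_neg]

variable [Algebra ℝ A]

/-- `(s + it)(f + ig) = (sf - tg) + i(sg + tf)`. -/
instance : SMul ℂ (VLComplexification A) :=
  ⟨fun c z => ⟨c.re • z.re - c.im • z.im, c.re • z.im + c.im • z.re⟩⟩

@[simp] theorem smul_re (c : ℂ) (z : VLComplexification A) :
    (c • z).re = c.re • z.re - c.im • z.im := rfl
@[simp] theorem smul_im (c : ℂ) (z : VLComplexification A) :
    (c • z).im = c.re • z.im + c.im • z.re := rfl

instance : Module ℂ (VLComplexification A) where
  one_smul x := by ext <;> simp
  mul_smul c d x := by ext <;> simp <;> module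
  smul_zero c := by ext <;> simp
  smul_add c x y := by ext <;> simp <;> module
  add_smul c d x := by ext <;> simp <;> module
  zero_smul x := by ext <;> simp

end Algebraic

variable {A : Type*} [ConditionallyCompleteLattice A] [Ring A] [Algebra ℝ A]

/-- The modulus `|f + ig| = sup {(cos θ) f + (sin θ) g : θ ∈ [0, 2π]}`, a positive element of the
real part `A`. -/
noncomputable def modulus (z : VLComplexification A) : A :=
  sSup ((fun θ : ℝ => Real.cos θ • z.re + Real.sin θ • z.im) '' Set.Icc 0 (2 * Real.pi))

/-- The supremum defining the modulus is a genuine one. -/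
theorem isLUB_modulus [UnivCompletePhiAlgebra A] (z : VLComplexification A) :
    IsLUB ((fun θ : ℝ => Real.cos θ • z.re + Real.sin θ • z.im) '' Set.Icc 0 (2 * Real.pi))
      (modulus z) := by
  have : IsOrderedAddMonoid A :=
    { add_le_add_left := fun x y h c => by
        simpa [add_comm] using UnivCompletePhiAlgebra.add_le_add_left' x y h c }
  have key : ∀ (t : ℝ) (x : A), -1 ≤ t → t ≤ 1 → t • x ≤ |x| := by
    intro t x h1 h2
    have e1 := UnivCompletePhiAlgebra.smul_nonneg' ((1 + t) / 2) (|x| - x) (by linarith)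
      (sub_nonneg.2 (le_abs_self x))
    have e2 := UnivCompletePhiAlgebra.smul_nonneg' ((1 - t) / 2) (|x| + x) (by linarith)
      (by simpa [sub_neg_eq_add] using sub_nonneg.2 (neg_le_abs x))
    have e3 := add_nonneg e1 e2
    have e4 : ((1 + t) / 2) • (|x| - x) + ((1 - t) / 2) • (|x| + x) = |x| - t • x := by module
    rw [e4] at e3
    exact sub_nonneg.1 e3
  refine isLUB_csSup ⟨_, 0, ⟨le_refl _, by positivity⟩, rfl⟩ ⟨|z.re| + |z.im|, ?_⟩
  rintro _ ⟨θ, -, rfl⟩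
  exact add_le_add (key _ _ (Real.neg_one_le_cos θ) (Real.cos_le_one θ))
    (key _ _ (Real.neg_one_le_sin θ) (Real.sin_le_one θ))

end VLComplexification

section OrderNotions

variable {A : Type*} [ConditionallyCompleteLattice A] [Ring A] [Algebra ℝ A]

/-- `p_n ↓ 0`: the sequence `p` is decreasing with infimum `0`. -/
def DecreasesToZero (p : ℕ → A) : Prop :=
  Antitone p ∧ IsGLB (Set.range p) 0

/-- Order convergence `x_n → x`: there is `p_n ↓ 0` with `|x_n - x| ≤ p_n` for all `n`. -/
def OrderTendsto (x : ℕ → VLComplexification A) (l : VLComplexification A) : Prop :=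
  ∃ p : ℕ → A, DecreasesToZero p ∧ ∀ n, (x n - l).modulus ≤ p n

/-- The series `∑ a_n` converges in order with sum `s`. -/
def HasOrderSum (a : ℕ → VLComplexification A) (s : VLComplexification A) : Prop :=
  OrderTendsto (fun m => ∑ n ∈ Finset.range (m + 1), a n) s

/-- `u` is a weak order unit: `u ≥ 0`, and only `0` is disjoint from `u`. -/
def IsWeakOrderUnit (u : A) : Prop :=
  0 ≤ u ∧ ∀ x : A, u ⊓ |x| = 0 → x = 0

/-- `x ≪ y`: the positive part `(y - x)⁺` is a weak order unit. -/
def OrderLL (x y : A) : Prop :=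
  IsWeakOrderUnit ((y - x) ⊔ 0)

/-- A set is order bounded if it is contained in an order interval. -/
def OrderBounded (s : Set A) : Prop :=
  ∃ l u : A, s ⊆ Set.Icc l u

/-- The power series `∑ a_n z^n` converges uniformly in order on `D`: for some `p_m ↓ 0` and some
sum function `S` on `D`, `|∑_{n ≤ m} a_n z^n - S z| ≤ p_m` for all `m` and all `z ∈ D`. -/
def ConvergesUniformlyInOrderOn (a : ℕ → VLComplexification A)
    (D : Set (VLComplexification A)) : Prop :=
  ∃ (S : VLComplexification A → VLComplexification A) (p : ℕ → A), DecreasesToZero p ∧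
    ∀ m, ∀ z ∈ D, (∑ n ∈ Finset.range (m + 1), a n * z ^ n - S z).modulus ≤ p m

/-- The set `Ω_S` of those `r ≥ 0` such that `∑ a_n z^n` converges uniformly in order on the order
closed ball `{z : |z| ≤ r}`. -/
def uniformConvergenceRadii (a : ℕ → VLComplexification A) : Set A :=
  {r | 0 ≤ r ∧ ConvergesUniformlyInOrderOn a {z | z.modulus ≤ r}}

/-- `ρ` is the radius of convergence of `∑ a_n z^n`: `Ω_S` is order bounded and `ρ = sup Ω_S`. -/
def IsRadiusOfConvergence (a : ℕ → VLComplexification A) (ρ : A) : Prop :=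
  IsLUB (uniformConvergenceRadii a) ρ

end OrderNotions

/-!
Write `r_n = ∑_{i ≤ n} a_i - s`, where `s` is the order sum of the coefficients, and let
`|r_n| ≤ p_n ↓ 0`. Summation by parts gives `S(z) - s = ∑ r_n (1 - z) z^n`, and splitting this
series at an index `m` gives
`|S(z) - s| ≤ m • (p_0 |1 - z|) + p_m |1 - z| (1 - |z|)⁻¹`.
Along `z_k` the first term tends to `0` for fixed `m`, and the second is at most `p_m M`, with `M`
an upper bound of the set in the third hypothesis.

The modulus is submultiplicative although the multiplication is not assumed commutative: writing
`z_θ` for the real part of `e^{-iθ} z`, the addition formula expresses `(zw)_{α+β}` through products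
of such real parts, and `|w_θ|` has infimum `0` over `θ`, because `w_θ` changes sign on `[0, π]` and
depends continuously on `θ`.

A weak order unit `u ≤ 1` is invertible: lateral completeness assembles local bounds for the inverse
into some `b` with `1 ≤ u b`, and such a `b` bounds the partial sums of the geometric series of
`1 - u`, whose supremum is `u⁻¹`.
-/

/-! ### Lattice ordered groups and f-rings -/

theorem inf_eq_zero_of_le {α : Type*} [SemilatticeInf α] [Zero α] {a b a' b' : α} (h : a ⊓ b = 0)
    (ha' : 0 ≤ a') (hb' : 0 ≤ b') (haa : a' ≤ a) (hbb : b' ≤ b) : a' ⊓ b' = 0 :=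
  le_antisymm ((inf_le_inf haa hbb).trans h.le) (le_inf ha' hb')

section LatticeOrderedGroup

variable {G : Type*} [Lattice G] [AddCommGroup G] [IsOrderedAddMonoid G]

theorem inf_add_le_add_inf {t a b : G} (ht : 0 ≤ t) (ha : 0 ≤ a) (hb : 0 ≤ b) :
    t ⊓ (a + b) ≤ t ⊓ a + t ⊓ b := by
  rw [inf_add, add_inf t b a]
  refine le_inf (inf_le_left.trans (le_add_of_nonneg_right (le_inf ht hb))) (le_inf ?_ inf_le_right)
  exact inf_le_left.trans (le_add_of_nonneg_left ha)

theorem inf_le_of_add_le {a b t : G} (ht : 0 ≤ t) (h : a + b ≤ t) : a ⊓ b ≤ t := by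
  have h2 : 2 • (a ⊓ b) ≤ 2 • t := calc
    2 • (a ⊓ b) = a ⊓ b + a ⊓ b := two_nsmul _
    _ ≤ a + b := add_le_add inf_le_left inf_le_right
    _ ≤ t + t := h.trans (le_add_of_nonneg_left ht)
    _ = 2 • t := (two_nsmul t).symm
  exact sub_nonneg.1 (nsmul_two_semiclosed (by rwa [nsmul_sub, sub_nonneg]))

theorem sup_eq_add_of_inf_eq_zero {a b : G} (h : a ⊓ b = 0) : a ⊔ b = a + b := by
  rw [← inf_add_sup a b, h, zero_add]

theorem abs_sub_eq_add_of_inf_eq_zero {a b : G} (h : a ⊓ b = 0) : |a - b| = a + b := by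
  rw [← sup_sub_inf_eq_abs_sub, inf_comm, sup_comm, h, sub_zero, sup_eq_add_of_inf_eq_zero h]

/-- A discrete intermediate value theorem. The invariant `q ≤ t ⊔ (x 0 ⊓ x k ⊔ -x 0 ⊓ -x k)` says
that, where `q ≤ t` fails, `x k` still has the sign of `x 0`. -/
theorem le_of_le_abs_of_abs_sub_le {x : ℕ → G} {q t : G} {N : ℕ} (ht : 0 ≤ t)
    (hstep : ∀ k, |x (k + 1) - x k| ≤ t) (hend : x N = -x 0) (hq : ∀ k, q ≤ |x k|) : q ≤ t := by
  let := AddCommGroup.toDistribLattice G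
  have cross (k : ℕ) : x k ⊓ -x (k + 1) ≤ t ∧ -x k ⊓ x (k + 1) ≤ t := by
    obtain ⟨hup, hdown⟩ := abs_le'.1 (hstep k)
    exact ⟨inf_le_of_add_le ht (by simpa [sub_eq_add_neg, add_comm] using hdown),
      inf_le_of_add_le ht (by simpa [sub_eq_add_neg, add_comm] using hup)⟩
  have same_sign (k : ℕ) : q ≤ t ⊔ (x 0 ⊓ x k ⊔ -x 0 ⊓ -x k) := by
    induction k with
    | zero => simpa only [inf_idem, abs] using (hq 0).trans le_sup_right
    | succ k ih =>
      calc q ≤ (t ⊔ (x 0 ⊓ x k ⊔ -x 0 ⊓ -x k)) ⊓ (x (k + 1) ⊔ -x (k + 1)) := le_inf ih (hq _)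
        _ ≤ t ⊔ (x 0 ⊓ x (k + 1) ⊔ -x 0 ⊓ -x (k + 1)) := ?_
      simp only [inf_sup_left, inf_sup_right, sup_le_iff]
      refine ⟨⟨inf_le_left.trans le_sup_left, ?_, ?_⟩, inf_le_left.trans le_sup_left, ?_, ?_⟩
      · exact (inf_le_inf_right _ inf_le_left).trans (le_sup_left.trans le_sup_right)
      · exact (inf_le_inf_right _ inf_le_right).trans ((cross k).2.trans le_sup_left)
      · exact (inf_le_inf_right _ inf_le_right).trans ((cross k).1.trans le_sup_left)
      · exact (inf_le_inf_right _ inf_le_left).trans (le_sup_right.trans le_sup_right)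
  refine (same_sign N).trans (sup_le le_rfl (sup_le ?_ ?_)) <;>
    exact inf_le_of_add_le ht (by simpa [hend] using ht)

theorem abs_smul_le_smul_abs [Module ℝ G] [PosSMulMono ℝ G] {t r : ℝ} (h : |t| ≤ r) (x : G) :
    |t • x| ≤ r • |x| := by
  have key {u : ℝ} (hu : |u| ≤ r) : u • x ≤ r • |x| := by
    obtain ⟨hlow, hup⟩ := abs_le.1 hu
    have h₁ : 0 ≤ ((r + u) / 2) • (|x| - x) :=
      smul_nonneg (by linarith) (sub_nonneg.2 (le_abs_self x))
    have h₂ : 0 ≤ ((r - u) / 2) • (|x| + x) :=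
      smul_nonneg (by linarith) (neg_le_iff_add_nonneg.1 (neg_le_abs x))
    refine sub_nonneg.1 ((add_nonneg h₁ h₂).trans_eq ?_)
    module
  exact abs_le'.2 ⟨key h, by simpa using key (u := -t) (by rwa [abs_neg])⟩

end LatticeOrderedGroup

theorem nonpos_of_forall_nsmul_le {G : Type*} [ConditionallyCompleteLattice G] [AddCommGroup G]
    [IsOrderedAddMonoid G] {y c : G} (h : ∀ n : ℕ, n • y ≤ c) : y ≤ 0 := by
  have hsup : IsLUB (Set.range fun n : ℕ => n • y) (⨆ n : ℕ, n • y) :=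
    isLUB_ciSup ⟨c, Set.forall_mem_range.2 h⟩
  have hle : (⨆ n : ℕ, n • y) ≤ (⨆ n : ℕ, n • y) - y :=
    hsup.2 <| Set.forall_mem_range.2 fun n =>
      le_sub_iff_add_le.2 ((succ_nsmul y n).symm.trans_le (hsup.1 ⟨n + 1, rfl⟩))
  simpa using hle

/-- A unital f-ring: a lattice ordered ring in which multiplication by positive elements preserves
disjointness. -/
class IsFRing (A : Type*) [Lattice A] [Ring A] : Prop extends IsOrderedAddMonoid A where
  protected mul_nonneg : ∀ {x y : A}, 0 ≤ x → 0 ≤ y → 0 ≤ x * y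
  mul_inf_eq_zero : ∀ {x y w : A}, 0 ≤ w → x ⊓ y = 0 → (w * x) ⊓ y = 0
  inf_mul_eq_zero : ∀ {x y w : A}, 0 ≤ w → x ⊓ y = 0 → (x * w) ⊓ y = 0

instance (priority := 100) UnivCompletePhiAlgebra.toIsFRing {A : Type*}
    [ConditionallyCompleteLattice A] [Ring A] [Algebra ℝ A] [UnivCompletePhiAlgebra A] :
    IsFRing A where
  add_le_add_left x y h c := by simpa only [add_comm] using add_le_add_left' x y h c
  mul_nonneg := mul_nonneg' _ _
  mul_inf_eq_zero := mul_left_disjoint _ _ _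
  inf_mul_eq_zero := mul_right_disjoint _ _ _

namespace IsFRing

variable {A : Type*} [Lattice A] [Ring A] [IsFRing A]

theorem mul_eq_zero_of_inf_eq_zero {x y : A} (h : x ⊓ y = 0) : x * y = 0 := by
  have hx : 0 ≤ x := h ▸ inf_le_left
  have hy : 0 ≤ y := h ▸ inf_le_right
  have hxy : y ⊓ (x * y) = 0 := by rw [inf_comm, inf_mul_eq_zero hy h]
  simpa only [inf_idem] using mul_inf_eq_zero hx hxy

theorem posPart_mul_negPart (x : A) : x⁺ * x⁻ = 0 :=
  mul_eq_zero_of_inf_eq_zero (posPart_inf_negPart_eq_zero x)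

theorem negPart_mul_posPart (x : A) : x⁻ * x⁺ = 0 :=
  mul_eq_zero_of_inf_eq_zero (by rw [inf_comm, posPart_inf_negPart_eq_zero])

protected theorem mul_self_nonneg (x : A) : 0 ≤ x * x := by
  have h : x * x = x⁺ * x⁺ + x⁻ * x⁻ := by
    conv_lhs => rw [← posPart_sub_negPart x]
    rw [mul_sub, sub_mul, sub_mul, posPart_mul_negPart, negPart_mul_posPart]
    abel
  rw [h]
  exact add_nonneg (IsFRing.mul_nonneg (posPart_nonneg x) (posPart_nonneg x))
    (IsFRing.mul_nonneg (negPart_nonneg x) (negPart_nonneg x))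

instance (priority := 100) toIsOrderedRing : IsOrderedRing A :=
  have : ZeroLEOneClass A := ⟨by simpa using IsFRing.mul_self_nonneg (1 : A)⟩
  IsOrderedRing.of_mul_nonneg fun _ _ => IsFRing.mul_nonneg

instance (priority := 100) toPosSMulMono [Algebra ℝ A] : PosSMulMono ℝ A :=
  PosSMulMono.of_smul_nonneg fun t ht x hx => by
    have h : t • x = (√t • (1 : A)) * (√t • 1) * x := by
      rw [smul_mul_smul_comm, Real.mul_self_sqrt ht, one_mul, smul_one_mul]
    rw [h]
    exact mul_nonneg (IsFRing.mul_self_nonneg _) hx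

theorem nsmul_inf_eq_zero {x y : A} (h : x ⊓ y = 0) (n : ℕ) : (n • x) ⊓ y = 0 := by
  rw [nsmul_eq_mul]
  exact mul_inf_eq_zero (Nat.cast_nonneg n) h

theorem abs_mul_of_nonneg_left {w : A} (hw : 0 ≤ w) (x : A) : |w * x| = w * |x| := by
  have h₁ : (w * x⁺) ⊓ x⁻ = 0 := mul_inf_eq_zero hw (posPart_inf_negPart_eq_zero x)
  have h₂ : (w * x⁺) ⊓ (w * x⁻) = 0 := by
    rw [inf_comm, mul_inf_eq_zero hw (by rw [inf_comm, h₁])]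
  calc |w * x| = |w * x⁺ - w * x⁻| := by rw [← mul_sub, posPart_sub_negPart]
    _ = w * x⁺ + w * x⁻ := abs_sub_eq_add_of_inf_eq_zero h₂
    _ = w * |x| := by rw [← mul_add, posPart_add_negPart]

theorem abs_mul_le (x y : A) : |x * y| ≤ |x| * |y| := by
  calc |x * y| = |x⁺ * y - x⁻ * y| := by rw [← sub_mul, posPart_sub_negPart]
    _ ≤ |x⁺ * y| + |x⁻ * y| := by
      rw [sub_eq_add_neg, ← abs_neg (x⁻ * y)]
      exact abs_add_le _ _
    _ = |x| * |y| := by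
      rw [abs_mul_of_nonneg_left (posPart_nonneg x), abs_mul_of_nonneg_left (negPart_nonneg x),
        ← add_mul, posPart_add_negPart]

theorem inverse_nonneg {u : A} (hu : 0 ≤ u) : 0 ≤ Ring.inverse u := by
  by_cases h : IsUnit u
  · have h_eq : Ring.inverse u = u * (Ring.inverse u * Ring.inverse u) := by
      rw [← mul_assoc, Ring.mul_inverse_cancel u h, one_mul]
    rw [h_eq]
    exact mul_nonneg hu (IsFRing.mul_self_nonneg _)
  · rw [Ring.inverse_non_unit u h]

end IsFRing

/-! ### The modulus -/

namespace VLComplexification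

section Phase

variable {A : Type*} [Ring A] [Algebra ℝ A]

/-- The real part of `e^{-iθ} z`. The modulus of `z` is the supremum of these elements. -/
noncomputable def phaseRe (z : VLComplexification A) (θ : ℝ) : A :=
  Real.cos θ • z.re + Real.sin θ • z.im

theorem phaseRe_zero (z : VLComplexification A) : z.phaseRe 0 = z.re := by simp [phaseRe]

theorem phaseRe_pi_div_two (z : VLComplexification A) : z.phaseRe (Real.pi / 2) = z.im := by
  simp [phaseRe]

theorem phaseRe_add_pi (z : VLComplexification A) (θ : ℝ) :
    z.phaseRe (θ + Real.pi) = -z.phaseRe θ := by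
  simp only [phaseRe, Real.cos_add_pi, Real.sin_add_pi]
  module

theorem phaseRe_add (z w : VLComplexification A) (θ : ℝ) :
    (z + w).phaseRe θ = z.phaseRe θ + w.phaseRe θ := by
  simp only [phaseRe, add_re, add_im]
  module

theorem phaseRe_mul (z w : VLComplexification A) (θ φ : ℝ) :
    (z * w).phaseRe (θ + φ) = z.phaseRe θ * w.phaseRe φ -
      z.phaseRe (θ + Real.pi / 2) * w.phaseRe (φ + Real.pi / 2) := by
  simp only [phaseRe, mul_re, mul_im, Real.cos_add, Real.sin_add, Real.cos_pi_div_two,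
    Real.sin_pi_div_two, add_mul, mul_add, smul_mul_smul_comm]
  module

variable [Lattice A] [IsOrderedAddMonoid A] [PosSMulMono ℝ A]

theorem abs_phaseRe_le_abs_add_abs (z : VLComplexification A) (θ : ℝ) :
    |z.phaseRe θ| ≤ |z.re| + |z.im| := by
  refine (abs_add_le _ _).trans (add_le_add ?_ ?_)
  · simpa only [one_smul] using abs_smul_le_smul_abs (Real.abs_cos_le_one θ) z.re
  · simpa only [one_smul] using abs_smul_le_smul_abs (Real.abs_sin_le_one θ) z.im

theorem abs_phaseRe_sub_phaseRe_le (z : VLComplexification A) (θ φ : ℝ) :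
    |z.phaseRe θ - z.phaseRe φ| ≤ |θ - φ| • (|z.re| + |z.im|) := by
  calc |z.phaseRe θ - z.phaseRe φ|
      = |(Real.cos θ - Real.cos φ) • z.re + (Real.sin θ - Real.sin φ) • z.im| := by
        simp only [phaseRe]
        congr 1
        module
    _ ≤ |θ - φ| • |z.re| + |θ - φ| • |z.im| := (abs_add_le _ _).trans (add_le_add
        (abs_smul_le_smul_abs (Real.abs_cos_sub_cos_le θ φ) _)
        (abs_smul_le_smul_abs (Real.abs_sin_sub_sin_le θ φ) _))
    _ = |θ - φ| • (|z.re| + |z.im|) := (smul_add _ _ _).symm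

end Phase

section Modulus

variable {A : Type*} [ConditionallyCompleteLattice A] [Ring A] [Algebra ℝ A]
  [IsOrderedAddMonoid A] [PosSMulMono ℝ A]

theorem phaseRe_le_modulus (z : VLComplexification A) (θ : ℝ) : z.phaseRe θ ≤ z.modulus := by
  have hbdd : BddAbove (z.phaseRe '' Set.Icc 0 (2 * Real.pi)) :=
    ⟨|z.re| + |z.im|, Set.forall_mem_image.2 fun φ _ =>
      (le_abs_self _).trans (z.abs_phaseRe_le_abs_add_abs φ)⟩
  have hmem := toIcoMod_mem_Ico Real.two_pi_pos 0 θ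
  rw [zero_add] at hmem
  have hθ : z.phaseRe (toIcoMod Real.two_pi_pos 0 θ) = z.phaseRe θ := by
    simp only [phaseRe, toIcoMod, zsmul_eq_mul, Real.cos_sub_int_mul_two_pi,
      Real.sin_sub_int_mul_two_pi]
  exact hθ ▸ le_csSup hbdd ⟨_, Set.Ico_subset_Icc_self hmem, rfl⟩

theorem modulus_le_iff {z : VLComplexification A} {b : A} :
    z.modulus ≤ b ↔ ∀ θ, z.phaseRe θ ≤ b :=
  ⟨fun h θ => (z.phaseRe_le_modulus θ).trans h, fun h =>
    csSup_le ⟨_, 0, ⟨le_rfl, Real.two_pi_pos.le⟩, rfl⟩ (Set.forall_mem_image.2 fun θ _ => h θ)⟩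

theorem abs_phaseRe_le_modulus (z : VLComplexification A) (θ : ℝ) : |z.phaseRe θ| ≤ z.modulus :=
  abs_le'.2 ⟨z.phaseRe_le_modulus θ, z.phaseRe_add_pi θ ▸ z.phaseRe_le_modulus (θ + Real.pi)⟩

theorem abs_re_le_modulus (z : VLComplexification A) : |z.re| ≤ z.modulus :=
  z.phaseRe_zero ▸ z.abs_phaseRe_le_modulus 0

theorem abs_im_le_modulus (z : VLComplexification A) : |z.im| ≤ z.modulus :=
  z.phaseRe_pi_div_two ▸ z.abs_phaseRe_le_modulus (Real.pi / 2)

theorem modulus_nonneg (z : VLComplexification A) : 0 ≤ z.modulus :=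
  (abs_nonneg _).trans z.abs_re_le_modulus

theorem modulus_le_abs_add_abs (z : VLComplexification A) : z.modulus ≤ |z.re| + |z.im| :=
  modulus_le_iff.2 fun θ => (le_abs_self _).trans (z.abs_phaseRe_le_abs_add_abs θ)

theorem modulus_zero : (0 : VLComplexification A).modulus = 0 :=
  le_antisymm (by simpa using modulus_le_abs_add_abs (0 : VLComplexification A)) (modulus_nonneg _)

theorem modulus_neg (z : VLComplexification A) : (-z).modulus = z.modulus := by
  have hle (w : VLComplexification A) : (-w).modulus ≤ w.modulus := modulus_le_iff.2 fun θ => by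
    simpa [phaseRe, add_comm] using w.phaseRe_le_modulus (θ + Real.pi)
  exact le_antisymm (hle z) (by simpa only [neg_neg] using hle (-z))

theorem modulus_sub_comm (z w : VLComplexification A) : (z - w).modulus = (w - z).modulus := by
  rw [← modulus_neg, neg_sub]

theorem modulus_add_le (z w : VLComplexification A) : (z + w).modulus ≤ z.modulus + w.modulus :=
  modulus_le_iff.2 fun θ =>
    (phaseRe_add z w θ).trans_le (add_le_add (z.phaseRe_le_modulus θ) (w.phaseRe_le_modulus θ))

theorem modulus_sub_le (z w : VLComplexification A) : (z - w).modulus ≤ z.modulus + w.modulus := by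
  rw [sub_eq_add_neg, ← modulus_neg w]
  exact modulus_add_le _ _

theorem modulus_sum_le {ι : Type*} (s : Finset ι) (f : ι → VLComplexification A) :
    (∑ i ∈ s, f i).modulus ≤ ∑ i ∈ s, (f i).modulus :=
  Finset.le_sum_of_subadditive _ modulus_zero.le modulus_add_le s f

theorem nonpos_of_forall_le_abs_phaseRe {z : VLComplexification A} {q : A}
    (h : ∀ θ, q ≤ |z.phaseRe θ|) : q ≤ 0 := by
  set C := |z.re| + |z.im|
  have hC : 0 ≤ C := add_nonneg (abs_nonneg _) (abs_nonneg _)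
  have small (n : ℕ) (hn : n ≠ 0) : q ≤ (Real.pi / n) • C := by
    have hδ : 0 ≤ Real.pi / n := by positivity
    refine le_of_le_abs_of_abs_sub_le (x := fun k => z.phaseRe (k * (Real.pi / n))) (N := n)
      (smul_nonneg hδ hC) (fun k => ?_) ?_ fun k => h _
    · convert z.abs_phaseRe_sub_phaseRe_le _ _ using 2
      push_cast
      rw [← sub_mul, add_sub_cancel_left, one_mul, abs_of_nonneg hδ]
    · have hπ : (n : ℝ) * (Real.pi / n) = 0 + Real.pi := by field_simp; ring
      simp only [hπ, phaseRe_add_pi, Nat.cast_zero, zero_mul]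
  refine nonpos_of_forall_nsmul_le (c := Real.pi • C) fun n => ?_
  rcases eq_or_ne n 0 with rfl | hn
  · simpa only [zero_smul] using smul_nonneg Real.pi_pos.le hC
  · calc n • q ≤ n • (Real.pi / n) • C := nsmul_le_nsmul_right (small n hn) n
      _ = Real.pi • C := by
        rw [← Nat.cast_smul_eq_nsmul ℝ, smul_smul, mul_div_cancel₀ _ (Nat.cast_ne_zero.2 hn)]

end Modulus

section FRing

variable {A : Type*} [ConditionallyCompleteLattice A] [Ring A] [Algebra ℝ A] [IsFRing A]

theorem modulus_one_le : (1 : VLComplexification A).modulus ≤ 1 := by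
  simpa [abs_of_nonneg (zero_le_one (α := A))] using
    modulus_le_abs_add_abs (1 : VLComplexification A)

theorem modulus_mul_le (z w : VLComplexification A) :
    (z * w).modulus ≤ z.modulus * w.modulus := by
  have hz := z.modulus_nonneg
  refine modulus_le_iff.2 fun ψ => sub_nonpos.1 ?_
  -- Every splitting `ψ = (ψ - θ) + θ` gives `(zw)_ψ ≤ |z| |w_θ| + |z| |w|`; `|w_θ|` has no positive
  -- lower bound as `θ` varies, so the first summand can be dropped.
  refine nonpos_of_forall_le_abs_phaseRe (z := ⟨z.modulus * w.re, z.modulus * w.im⟩) fun θ => ?_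
  have hphase : phaseRe ⟨z.modulus * w.re, z.modulus * w.im⟩ θ = z.modulus * w.phaseRe θ := by
    simp only [phaseRe, mul_add, mul_smul_comm]
  have hmul (α β : ℝ) : |z.phaseRe α * w.phaseRe β| ≤ z.modulus * |w.phaseRe β| :=
    (IsFRing.abs_mul_le _ _).trans
      (mul_le_mul_of_nonneg_right (z.abs_phaseRe_le_modulus α) (abs_nonneg _))
  rw [hphase, IsFRing.abs_mul_of_nonneg_left hz, sub_le_iff_le_add, ← sub_add_cancel ψ θ,
    phaseRe_mul, sub_eq_add_neg]
  refine add_le_add ((le_abs_self _).trans (by simpa using hmul (ψ - θ) θ)) ?_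
  exact (neg_le_abs _).trans ((hmul _ _).trans
    (mul_le_mul_of_nonneg_left (w.abs_phaseRe_le_modulus _) hz))

theorem modulus_pow_le (z : VLComplexification A) (n : ℕ) : (z ^ n).modulus ≤ z.modulus ^ n := by
  induction n with
  | zero => simpa only [pow_zero] using modulus_one_le
  | succ n ih =>
    rw [pow_succ, pow_succ]
    exact (modulus_mul_le _ _).trans (mul_le_mul_of_nonneg_right ih z.modulus_nonneg)

end FRing

end VLComplexification

/-! ### Order convergence -/

theorem exists_forall_abs_sub_le {G : Type*} [ConditionallyCompleteLattice G] [AddCommGroup G]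
    [IsOrderedAddMonoid G] {x p : ℕ → G} (h : ∀ m n, m ≤ n → |x n - x m| ≤ p m) :
    ∃ l, ∀ n, |x n - l| ≤ p n := by
  have hp (n : ℕ) : 0 ≤ p n := by simpa using h n n le_rfl
  have hle (m n : ℕ) : x m - p m ≤ x n + p n := by
    rw [sub_le_iff_le_add]
    rcases le_total m n with hmn | hnm
    · have hx := sub_le_comm.1 ((neg_sub _ _).symm.trans_le ((neg_le_abs _).trans (h m n hmn)))
      exact (sub_le_iff_le_add.1 hx).trans
        (add_le_add_left (le_add_of_nonneg_right (hp n)) (p m))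
    · have hx := sub_le_iff_le_add'.1 ((le_abs_self _).trans (h n m hnm))
      exact hx.trans (le_add_of_nonneg_right (hp m))
  refine ⟨⨆ m, (x m - p m), fun n => abs_le'.2 ⟨?_, ?_⟩⟩
  · exact sub_le_comm.1 (le_ciSup ⟨x 0 + p 0, Set.forall_mem_range.2 fun m => hle m 0⟩ n)
  · rw [neg_sub, sub_le_iff_le_add']
    exact ciSup_le fun m => hle m n

namespace DecreasesToZero

variable {A : Type*} [ConditionallyCompleteLattice A] [Ring A] {p q r x : ℕ → A}

theorem nonneg (hp : DecreasesToZero p) (n : ℕ) : 0 ≤ p n :=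
  hp.2.1 ⟨n, rfl⟩

theorem of_antitone (hp : Antitone p) (h0 : ∀ n, 0 ≤ p n) (h : ∀ y, (∀ n, y ≤ p n) → y ≤ 0) :
    DecreasesToZero p :=
  ⟨hp, Set.forall_mem_range.2 h0, fun y hy => h y (Set.forall_mem_range.1 hy)⟩

section OrderedGroup

variable [IsOrderedAddMonoid A]

theorem le_of_forall_ge (hp : DecreasesToZero p) {y c : A} (m : ℕ)
    (h : ∀ n, m ≤ n → y ≤ c + p n) : y ≤ c := by
  refine sub_nonpos.1 (hp.2.2 (Set.forall_mem_range.2 fun n => ?_))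
  exact (sub_le_iff_le_add'.2 (h (max m n) (le_max_left _ _))).trans (hp.1 (le_max_right _ _))

theorem le_of_forall (hp : DecreasesToZero p) {y c : A} (h : ∀ n, y ≤ c + p n) : y ≤ c :=
  hp.le_of_forall_ge 0 fun n _ => h n

theorem eq_of_forall_abs_sub_le (hp : DecreasesToZero p) {y c : A} (h : ∀ n, |y - c| ≤ p n) :
    y = c := by
  have h0 : |y - c| ≤ 0 := hp.le_of_forall fun n => (h n).trans (zero_add (p n)).ge
  obtain ⟨hyc, hcy⟩ := abs_le'.1 h0
  exact le_antisymm (sub_nonpos.1 hyc) (sub_nonpos.1 (by rwa [neg_sub] at hcy))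

theorem add (hp : DecreasesToZero p) (hq : DecreasesToZero q) :
    DecreasesToZero fun n => p n + q n := by
  refine of_antitone (fun m n h => add_le_add (hp.1 h) (hq.1 h))
    (fun n => add_nonneg (hp.nonneg n) (hq.nonneg n)) fun y hy => hp.le_of_forall fun m => ?_
  rw [zero_add]
  exact hq.le_of_forall_ge m fun n hmn => (hy n).trans (add_le_add_left (hp.1 hmn) (q n))

theorem nsmul (hp : DecreasesToZero p) (k : ℕ) : DecreasesToZero fun n => k • p n := by
  induction k with
  | zero => exact of_antitone (fun _ _ _ => by simp) (by simp) (by simp)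
  | succ k ih => simpa only [succ_nsmul] using ih.add hp

theorem ciSup_sub {B : ℕ → A} (hB : Monotone B) (hbdd : BddAbove (Set.range B)) :
    DecreasesToZero fun n => (⨆ m, B m) - B n := by
  refine of_antitone (fun m n h => sub_le_sub_left (hB h) _)
    (fun n => sub_nonneg.2 (le_ciSup hbdd n)) fun y hy => ?_
  have hle : (⨆ m, B m) ≤ (⨆ m, B m) - y := ciSup_le fun n => le_sub_comm.1 (hy n)
  simpa using hle

theorem of_forall_nsmul_le (hp : Antitone p) (h0 : ∀ n, 0 ≤ p n) {c : A}
    (h : ∀ n, n • p n ≤ c) : DecreasesToZero p :=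
  of_antitone hp h0 fun _ hy =>
    nonpos_of_forall_nsmul_le fun n => (nsmul_le_nsmul_right (hy n) n).trans (h n)

theorem of_forall_le_nsmul_add (hx : Antitone x) (h0 : ∀ n, 0 ≤ x n) (hq : DecreasesToZero q)
    (hr : DecreasesToZero r) (h : ∀ n m : ℕ, x n ≤ m • q n + r m) : DecreasesToZero x :=
  of_antitone hx h0 fun y hy => hr.le_of_forall fun m => (hq.nsmul m).le_of_forall fun n => by
    rw [zero_add, add_comm]
    exact (hy n).trans (h n m)

end OrderedGroup

end DecreasesToZero

namespace IsFRing

variable {A : Type*} [Lattice A] [Ring A] [IsFRing A]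

theorem antitone_posPart_sub_natCast (c : A) : Antitone fun n : ℕ => (c - n)⁺ :=
  fun _ _ h => posPart_mono (sub_le_sub_left (Nat.mono_cast h) c)

theorem nsmul_posPart_sub_natCast_le {c : A} (hc : 0 ≤ c) (n : ℕ) : n • (c - n)⁺ ≤ c * c := by
  have hmul : (c - n) * (c - n)⁺ = (c - n)⁺ * (c - n)⁺ := by
    conv_lhs => rw [← posPart_sub_negPart (c - n)]
    rw [sub_mul, posPart_sub_negPart, negPart_mul_posPart, sub_zero]
  have hnonneg : 0 ≤ (c - n) * (c - n)⁺ := hmul ▸ IsFRing.mul_self_nonneg _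
  calc n • (c - n)⁺ ≤ c * (c - n)⁺ := by rwa [sub_mul, ← nsmul_eq_mul, sub_nonneg] at hnonneg
    _ ≤ c * c :=
      mul_le_mul_of_nonneg_left (sup_le (sub_le_self _ (Nat.cast_nonneg n)) hc) hc

end IsFRing

namespace DecreasesToZero

variable {A : Type*} [ConditionallyCompleteLattice A] [Ring A] [IsFRing A] {p : ℕ → A} {c : A}

theorem const_mul (hp : DecreasesToZero p) (hc : 0 ≤ c) : DecreasesToZero fun n => c * p n := by
  have hr : DecreasesToZero fun m : ℕ => (c - m)⁺ * p 0 :=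
    of_forall_nsmul_le
      (fun m n h =>
        mul_le_mul_of_nonneg_right (IsFRing.antitone_posPart_sub_natCast c h) (hp.nonneg 0))
      (fun m => mul_nonneg (posPart_nonneg _) (hp.nonneg 0)) (c := c * c * p 0) fun m => by
        rw [← smul_mul_assoc]
        exact mul_le_mul_of_nonneg_right (IsFRing.nsmul_posPart_sub_natCast_le hc m) (hp.nonneg 0)
  refine of_forall_le_nsmul_add (fun m n h => mul_le_mul_of_nonneg_left (hp.1 h) hc)
    (fun n => mul_nonneg hc (hp.nonneg n)) hp hr fun n m => ?_
  -- Replacing `c` by `c ⊓ m` costs at most `(c - m)⁺ * p 0`, uniformly in `n`.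
  calc c * p n ≤ (m + (c - m)⁺) * p n :=
        mul_le_mul_of_nonneg_right (sub_le_iff_le_add'.1 (le_posPart _)) (hp.nonneg n)
    _ = m • p n + (c - m)⁺ * p n := by rw [add_mul, nsmul_eq_mul]
    _ ≤ m • p n + (c - m)⁺ * p 0 :=
        add_le_add_right (mul_le_mul_of_nonneg_left (hp.1 n.zero_le) (posPart_nonneg _)) _

theorem mul_const (hp : DecreasesToZero p) (hc : 0 ≤ c) : DecreasesToZero fun n => p n * c := by
  have hr : DecreasesToZero fun m : ℕ => p 0 * (c - m)⁺ :=
    of_forall_nsmul_le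
      (fun m n h =>
        mul_le_mul_of_nonneg_left (IsFRing.antitone_posPart_sub_natCast c h) (hp.nonneg 0))
      (fun m => mul_nonneg (hp.nonneg 0) (posPart_nonneg _)) (c := p 0 * (c * c)) fun m => by
        rw [← mul_smul_comm]
        exact mul_le_mul_of_nonneg_left (IsFRing.nsmul_posPart_sub_natCast_le hc m) (hp.nonneg 0)
  refine of_forall_le_nsmul_add (fun m n h => mul_le_mul_of_nonneg_right (hp.1 h) hc)
    (fun n => mul_nonneg (hp.nonneg n) hc) hp hr fun n m => ?_
  calc p n * c ≤ p n * (m + (c - m)⁺) :=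
        mul_le_mul_of_nonneg_left (sub_le_iff_le_add'.1 (le_posPart _)) (hp.nonneg n)
    _ = m • p n + p n * (c - m)⁺ := by rw [mul_add, ← (Nat.cast_commute m (p n)).eq, nsmul_eq_mul]
    _ ≤ m • p n + p 0 * (c - m)⁺ :=
        add_le_add_right (mul_le_mul_of_nonneg_right (hp.1 n.zero_le) (posPart_nonneg _)) _

end DecreasesToZero

section OrderConvergence

open VLComplexification

variable {A : Type*} [ConditionallyCompleteLattice A] [Ring A] [Algebra ℝ A]
  [IsOrderedAddMonoid A] [PosSMulMono ℝ A]

theorem orderTendsto_of_modulus_le {x : ℕ → VLComplexification A} {l : VLComplexification A}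
    {q r : ℕ → A} (hq : DecreasesToZero q) (hr : DecreasesToZero r)
    (h : ∀ n m, (x n - l).modulus ≤ m • q n + r m) : OrderTendsto x l := by
  have htail (k m i : ℕ) : (x (k + i) - l).modulus ≤ m • q k + r m :=
    (h _ m).trans (add_le_add_left (nsmul_le_nsmul_right (hq.1 (k.le_add_right i)) m) _)
  have hbdd (k : ℕ) : BddAbove (Set.range fun i => (x (k + i) - l).modulus) :=
    ⟨0 • q k + r 0, Set.forall_mem_range.2 (htail k 0)⟩
  have hle (k : ℕ) : (x k - l).modulus ≤ ⨆ i, (x (k + i) - l).modulus := le_ciSup (hbdd k) 0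
  refine ⟨fun k => ⨆ i, (x (k + i) - l).modulus, ?_, hle⟩
  refine DecreasesToZero.of_forall_le_nsmul_add (fun j k hjk => ciSup_le fun i => ?_)
    (fun k => (modulus_nonneg _).trans (hle k)) hq hr fun k m => ciSup_le (htail k m)
  obtain ⟨d, rfl⟩ := Nat.exists_eq_add_of_le hjk
  rw [add_assoc]
  exact le_ciSup (hbdd j) (d + i)

theorem exists_orderTendsto_of_modulus_sub_le {x : ℕ → VLComplexification A} {p : ℕ → A}
    (hp : DecreasesToZero p) (h : ∀ m n, m ≤ n → (x n - x m).modulus ≤ p m) :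
    ∃ l, OrderTendsto x l := by
  obtain ⟨r, hr⟩ := exists_forall_abs_sub_le (x := fun n => (x n).re) (p := p) fun m n hmn =>
    (sub_re (x n) (x m)) ▸ (abs_re_le_modulus _).trans (h m n hmn)
  obtain ⟨s, hs⟩ := exists_forall_abs_sub_le (x := fun n => (x n).im) (p := p) fun m n hmn =>
    (sub_im (x n) (x m)) ▸ (abs_im_le_modulus _).trans (h m n hmn)
  refine ⟨⟨r, s⟩, _, hp.add hp, fun n => (modulus_le_abs_add_abs _).trans ?_⟩
  rw [sub_re, sub_im]
  exact add_le_add (hr n) (hs n)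

theorem exists_hasOrderSum_of_modulus_le {c : ℕ → VLComplexification A} {b : ℕ → A}
    (hcb : ∀ n, (c n).modulus ≤ b n)
    (hb : BddAbove (Set.range fun N => ∑ n ∈ Finset.range N, b n)) : ∃ s, HasOrderSum c s := by
  let B : ℕ → A := fun m => ∑ n ∈ Finset.range (m + 1), b n
  have hB : Monotone B := fun m n hmn =>
    Finset.sum_le_sum_of_subset_of_nonneg (Finset.range_subset_range.2 (Nat.succ_le_succ hmn))
      fun i _ _ => (modulus_nonneg _).trans (hcb i)
  have hbdd : BddAbove (Set.range B) :=
    hb.mono (Set.range_comp_subset_range Nat.succ fun N => ∑ n ∈ Finset.range N, b n)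
  refine exists_orderTendsto_of_modulus_sub_le (DecreasesToZero.ciSup_sub hB hbdd)
    fun m n hmn => ?_
  calc (∑ i ∈ Finset.range (n + 1), c i - ∑ i ∈ Finset.range (m + 1), c i).modulus
      = (∑ i ∈ Finset.Ico (m + 1) (n + 1), c i).modulus := by
        rw [Finset.sum_Ico_eq_sub _ (Nat.succ_le_succ hmn)]
    _ ≤ ∑ i ∈ Finset.Ico (m + 1) (n + 1), b i :=
        (modulus_sum_le _ _).trans (Finset.sum_le_sum fun i _ => hcb i)
    _ = B n - B m := Finset.sum_Ico_eq_sub _ (Nat.succ_le_succ hmn)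
    _ ≤ (⨆ i, B i) - B m := sub_le_sub_right (le_ciSup hbdd n) _

theorem HasOrderSum.exists_modulus_le {a : ℕ → VLComplexification A} {s : VLComplexification A}
    (h : HasOrderSum a s) : ∃ b : A, ∀ n, (a n).modulus ≤ b := by
  obtain ⟨p, hp, hps⟩ := h
  have hsum (n : ℕ) : (∑ i ∈ Finset.range n, a i - s).modulus ≤ s.modulus ⊔ p 0 := by
    cases n with
    | zero => simp [modulus_neg]
    | succ n => exact (hps n).trans ((hp.1 n.zero_le).trans le_sup_right)
  refine ⟨s.modulus ⊔ p 0 + s.modulus ⊔ p 0, fun n => ?_⟩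
  have hterm : a n = (∑ i ∈ Finset.range (n + 1), a i - s) - (∑ i ∈ Finset.range n, a i - s) := by
    rw [Finset.sum_range_succ]
    abel
  rw [hterm]
  exact (modulus_sub_le _ _).trans (add_le_add (hsum _) (hsum _))

end OrderConvergence

/-! ### The Abel estimate -/

section GeometricSeries

variable {A : Type*} [Lattice A] [Ring A] [IsFRing A] {w : A}

theorem geom_sum_le_inverse (hw : 0 ≤ w) (hw1 : w ≤ 1) (hu : IsUnit (1 - w)) (N : ℕ) :
    ∑ n ∈ Finset.range N, w ^ n ≤ Ring.inverse (1 - w) := by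
  calc ∑ n ∈ Finset.range N, w ^ n
      = (1 - w ^ N) * Ring.inverse (1 - w) := by
        rw [← geom_sum_mul_neg, mul_assoc, Ring.mul_inverse_cancel _ hu, mul_one]
    _ ≤ Ring.inverse (1 - w) :=
        mul_le_of_le_one_left (IsFRing.inverse_nonneg (sub_nonneg.2 hw1))
          (sub_le_self _ (pow_nonneg hw N))

theorem sum_antitone_mul_geom_le {p : ℕ → A} {x : A} (hp : Antitone p) (hp0 : ∀ n, 0 ≤ p n)
    (hx : 0 ≤ x) (hw : 0 ≤ w) (hw1 : w ≤ 1) (hu : IsUnit (1 - w)) (m N : ℕ) :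
    ∑ n ∈ Finset.range N, p n * (x * w ^ n) ≤
      m • (p 0 * x) + p m * (x * Ring.inverse (1 - w)) := by
  have hxw (n : ℕ) : 0 ≤ x * w ^ n := mul_nonneg hx (pow_nonneg hw n)
  have hhead : ∑ n ∈ Finset.range m, p n * (x * w ^ n) ≤ m • (p 0 * x) := by
    simpa only [Finset.card_range] using Finset.sum_le_card_nsmul (Finset.range m) _ (p 0 * x)
      fun n _ => mul_le_mul (hp n.zero_le) (mul_le_of_le_one_right hx (pow_le_one₀ hw hw1))
        (hxw n) (hp0 0)
  have htail : ∑ n ∈ Finset.range N, p (m + n) * (x * w ^ (m + n)) ≤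
      p m * (x * Ring.inverse (1 - w)) := by
    calc ∑ n ∈ Finset.range N, p (m + n) * (x * w ^ (m + n))
        ≤ ∑ n ∈ Finset.range N, p m * (x * w ^ n) := Finset.sum_le_sum fun n _ =>
          mul_le_mul (hp (m.le_add_right n)) (mul_le_mul_of_nonneg_left
            (pow_le_pow_of_le_one hw hw1 (n.le_add_left m)) hx) (hxw _) (hp0 m)
      _ = p m * (x * ∑ n ∈ Finset.range N, w ^ n) := by rw [Finset.mul_sum, Finset.mul_sum]
      _ ≤ p m * (x * Ring.inverse (1 - w)) := mul_le_mul_of_nonneg_left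
          (mul_le_mul_of_nonneg_left (geom_sum_le_inverse hw hw1 hu N) hx) (hp0 m)
  calc ∑ n ∈ Finset.range N, p n * (x * w ^ n)
      ≤ ∑ n ∈ Finset.range (m + N), p n * (x * w ^ n) :=
        Finset.sum_le_sum_of_subset_of_nonneg (Finset.range_subset_range.2 (N.le_add_left m))
          fun n _ _ => mul_nonneg (hp0 n) (hxw n)
    _ = ∑ n ∈ Finset.range m, p n * (x * w ^ n) +
          ∑ n ∈ Finset.range N, p (m + n) * (x * w ^ (m + n)) := Finset.sum_range_add _ m N
    _ ≤ m • (p 0 * x) + p m * (x * Ring.inverse (1 - w)) := add_le_add hhead htail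

end GeometricSeries

theorem sum_mul_pow_sub_eq {R : Type*} [Ring R] (a : ℕ → R) (s z : R) (N : ℕ) :
    ∑ n ∈ Finset.range (N + 1), a n * z ^ n - s =
      ∑ n ∈ Finset.range (N + 1), (∑ i ∈ Finset.range (n + 1), a i - s) * ((1 - z) * z ^ n) +
        (∑ i ∈ Finset.range (N + 1), a i - s) * z ^ (N + 1) := by
  induction N with
  | zero =>
    simp only [zero_add, Finset.sum_range_one, pow_zero, pow_one]
    noncomm_ring
  | succ N ih =>
    rw [Finset.sum_range_succ, add_sub_right_comm, ih,
      Finset.sum_range_succ (fun n => (∑ i ∈ Finset.range (n + 1), a i - s) * _) (N + 1),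
      Finset.sum_range_succ a (N + 1), pow_succ' z (N + 1)]
    noncomm_ring

section AbelEstimate

open VLComplexification

variable {A : Type*} [ConditionallyCompleteLattice A] [Ring A] [Algebra ℝ A] [IsFRing A]
  {a : ℕ → VLComplexification A} {s z S : VLComplexification A} {p : ℕ → A}

theorem HasOrderSum.exists_hasOrderSum_mul_pow (hs : HasOrderSum a s) (hz : z.modulus ≤ 1)
    (hu : IsUnit (1 - z.modulus)) : ∃ S, HasOrderSum (fun n => a n * z ^ n) S := by
  obtain ⟨b, hb⟩ := hs.exists_modulus_le
  have hb0 : 0 ≤ b := (modulus_nonneg _).trans (hb 0)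
  refine exists_hasOrderSum_of_modulus_le (b := fun n => b * z.modulus ^ n) (fun n => ?_)
    ⟨b * Ring.inverse (1 - z.modulus), Set.forall_mem_range.2 fun N => ?_⟩
  · exact (modulus_mul_le _ _).trans
      (mul_le_mul (hb n) (modulus_pow_le z n) (modulus_nonneg _) hb0)
  · rw [← Finset.mul_sum]
    exact mul_le_mul_of_nonneg_left (geom_sum_le_inverse z.modulus_nonneg hz hu N) hb0

theorem modulus_sum_mul_pow_sub_le (hp : Antitone p)
    (hps : ∀ n, (∑ i ∈ Finset.range (n + 1), a i - s).modulus ≤ p n) (hz : z.modulus ≤ 1)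
    (hu : IsUnit (1 - z.modulus)) (m N : ℕ) :
    (∑ n ∈ Finset.range (N + 1), a n * z ^ n - s).modulus ≤
      m • (p 0 * (1 - z).modulus) + p m * ((1 - z).modulus * Ring.inverse (1 - z.modulus)) +
        p N := by
  have hp0 (n : ℕ) : 0 ≤ p n := (modulus_nonneg _).trans (hps n)
  have hz0 := z.modulus_nonneg
  have hterm (n : ℕ) : ((∑ i ∈ Finset.range (n + 1), a i - s) * ((1 - z) * z ^ n)).modulus ≤
      p n * ((1 - z).modulus * z.modulus ^ n) := by
    refine (modulus_mul_le _ _).trans (mul_le_mul (hps n) ?_ (modulus_nonneg _) (hp0 n))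
    exact (modulus_mul_le _ _).trans
      (mul_le_mul_of_nonneg_left (modulus_pow_le z n) (modulus_nonneg _))
  have hlast : ((∑ i ∈ Finset.range (N + 1), a i - s) * z ^ (N + 1)).modulus ≤ p N := by
    refine (modulus_mul_le _ _).trans ((mul_le_of_le_one_right (modulus_nonneg _) ?_).trans (hps N))
    exact (modulus_pow_le z _).trans (pow_le_one₀ hz0 hz)
  rw [sum_mul_pow_sub_eq]
  refine (modulus_add_le _ _).trans (add_le_add ?_ hlast)
  exact (modulus_sum_le _ _).trans ((Finset.sum_le_sum fun n _ => hterm n).trans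
    (sum_antitone_mul_geom_le hp hp0 (modulus_nonneg _) hz0 hz hu m (N + 1)))

theorem HasOrderSum.modulus_sub_le (hS : HasOrderSum (fun n => a n * z ^ n) S)
    (hp : DecreasesToZero p) (hps : ∀ n, (∑ i ∈ Finset.range (n + 1), a i - s).modulus ≤ p n)
    (hz : z.modulus ≤ 1) (hu : IsUnit (1 - z.modulus)) (m : ℕ) :
    (S - s).modulus ≤
      m • (p 0 * (1 - z).modulus) + p m * ((1 - z).modulus * Ring.inverse (1 - z.modulus)) := by
  obtain ⟨q, hq, hqS⟩ := hS
  refine (hp.add hq).le_of_forall fun N => ?_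
  set T := ∑ n ∈ Finset.range (N + 1), a n * z ^ n
  calc (S - s).modulus = ((T - s) - (T - S)).modulus := by rw [sub_sub_sub_cancel_left]
    _ ≤ (T - s).modulus + (T - S).modulus := VLComplexification.modulus_sub_le _ _
    _ ≤ _ + p N + q N := add_le_add (modulus_sum_mul_pow_sub_le hp.1 hps hz hu m N) (hqS N)
    _ = _ := add_assoc _ _ _

end AbelEstimate

/-! ### Invertibility of weak order units -/

theorem ciSup_inf_eq_zero {ι G : Type*} [Nonempty ι] [ConditionallyCompleteLattice G]
    [AddCommGroup G] [IsOrderedAddMonoid G] {f : ι → G} {c : G} (hf : BddAbove (Set.range f))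
    (h : ∀ i, f i ⊓ c = 0) : (⨆ i, f i) ⊓ c = 0 := by
  obtain ⟨j⟩ := ‹Nonempty ι›
  have hc : 0 ≤ c := (h j).ge.trans inf_le_right
  have hsup : 0 ≤ ⨆ i, f i := ((h j).ge.trans inf_le_left).trans (le_ciSup hf j)
  refine le_antisymm ?_ (le_inf hsup hc)
  have hle : ⨆ i, f i ≤ (⨆ i, f i) - (⨆ i, f i) ⊓ c := ciSup_le fun i => by
    have hdisj : f i ⊓ ((⨆ i, f i) ⊓ c) = 0 :=
      inf_eq_zero_of_le (h i) ((h i).ge.trans inf_le_left) (le_inf hsup hc) le_rfl inf_le_right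
    rw [le_sub_iff_add_le, ← sup_eq_add_of_inf_eq_zero hdisj]
    exact sup_le (le_ciSup hf i) inf_le_left
  simpa using hle

section Components

variable {A : Type*} [ConditionallyCompleteLattice A] [Ring A]

/-- The component of `1` in the band generated by `y ≥ 0`. -/
noncomputable def unitComponent (y : A) : A :=
  ⨆ k : ℕ, k • y ⊓ 1

/-- The component of `1` on which `n • u > 1`, that is, in the band generated by `(n • u - 1)⁺`. -/
noncomputable def levelComponent (u : A) (n : ℕ) : A :=
  unitComponent (n • u - 1)⁺

theorem unitComponent_le_one (y : A) : unitComponent y ≤ 1 :=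
  ciSup_le fun _ => inf_le_right

theorem bddAbove_range_nsmul_inf_one (y : A) : BddAbove (Set.range fun k : ℕ => k • y ⊓ 1) :=
  ⟨1, Set.forall_mem_range.2 fun _ => inf_le_right⟩

theorem nsmul_inf_one_le_unitComponent (y : A) (k : ℕ) : k • y ⊓ 1 ≤ unitComponent y :=
  le_ciSup (bddAbove_range_nsmul_inf_one y) k

variable [IsFRing A] {u x y c : A}

theorem unitComponent_nonneg (y : A) : 0 ≤ unitComponent y := by
  simpa using nsmul_inf_one_le_unitComponent y 0

theorem unitComponent_mono : Monotone (unitComponent (A := A)) := fun _ _ h =>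
  ciSup_le fun k => (inf_le_inf_right 1 (nsmul_le_nsmul_right h k)).trans
    (nsmul_inf_one_le_unitComponent _ k)

theorem unitComponent_inf_eq_zero (h : y ⊓ c = 0) : unitComponent y ⊓ c = 0 :=
  ciSup_inf_eq_zero (bddAbove_range_nsmul_inf_one y) fun k =>
    inf_eq_zero_of_le (IsFRing.nsmul_inf_eq_zero h k)
      (le_inf (nsmul_nonneg (h.ge.trans inf_le_left) k) zero_le_one) (h.ge.trans inf_le_right)
      inf_le_left le_rfl

theorem inf_one_sub_unitComponent (hy : 0 ≤ y) : y ⊓ (1 - unitComponent y) = 0 := by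
  refine le_antisymm ?_ (le_inf hy (sub_nonneg.2 (unitComponent_le_one y)))
  have hle : unitComponent y ≤ unitComponent y - y ⊓ (1 - unitComponent y) := by
    refine ciSup_le fun k => le_sub_iff_add_le.2 ?_
    refine (le_inf ?_ ?_).trans (nsmul_inf_one_le_unitComponent y (k + 1))
    · rw [succ_nsmul]
      exact add_le_add inf_le_left inf_le_left
    · exact (add_le_add (nsmul_inf_one_le_unitComponent y k) inf_le_right).trans_eq
        (add_sub_cancel _ _)
  simpa using hle

theorem levelComponent_mono (hu : 0 ≤ u) : Monotone (levelComponent u) := fun _ _ h =>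
  unitComponent_mono (posPart_mono (sub_le_sub_right (nsmul_le_nsmul_left hu h) 1))

theorem levelComponent_zero (u : A) : levelComponent u 0 = 0 := by
  simp [levelComponent, unitComponent]

theorem levelComponent_inf_one_sub (u : A) (n : ℕ) :
    levelComponent u n ⊓ (1 - levelComponent u n) = 0 :=
  unitComponent_inf_eq_zero (inf_one_sub_unitComponent (posPart_nonneg _))

theorem levelComponent_sub_inf_levelComponent_sub (hu : 0 ≤ u) {m n : ℕ} (hmn : m < n) :
    (levelComponent u (m + 1) - levelComponent u m) ⊓
      (levelComponent u (n + 1) - levelComponent u n) = 0 := by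
  have hmono := levelComponent_mono hu
  refine inf_eq_zero_of_le (levelComponent_inf_one_sub u n) (sub_nonneg.2 (hmono m.le_succ))
    (sub_nonneg.2 (hmono n.le_succ)) ?_ (sub_le_sub_right (unitComponent_le_one _) _)
  exact (sub_le_self _ (unitComponent_nonneg _)).trans (hmono hmn)

theorem le_nsmul_mul_of_le_levelComponent {n : ℕ} (hx : 0 ≤ x) (h : x ≤ levelComponent u n) :
    x ≤ n • u * x := by
  have hdisj : (n • u - 1)⁻ ⊓ x = 0 := by
    rw [inf_comm]
    exact inf_eq_zero_of_le (unitComponent_inf_eq_zero (posPart_inf_negPart_eq_zero _)) hx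
      (negPart_nonneg _) h le_rfl
  have hnonneg : 0 ≤ (n • u - 1) * x := by
    rw [← posPart_sub_negPart (n • u - 1), sub_mul, IsFRing.mul_eq_zero_of_inf_eq_zero hdisj,
      sub_zero]
    exact mul_nonneg (posPart_nonneg _) hx
  rwa [sub_mul, one_mul, sub_nonneg] at hnonneg

end Components

section WeakOrderUnits

variable {A : Type*} [ConditionallyCompleteLattice A] [Ring A] [IsFRing A] {u t x y : A}

theorem IsWeakOrderUnit.eq_zero_of_forall_inf_eq_zero (hu : IsWeakOrderUnit u) (ht : 0 ≤ t)
    (h : ∀ n : ℕ, t ⊓ (n • u - 1)⁺ = 0) : t = 0 := by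
  refine hu.2 t ?_
  rw [abs_of_nonneg ht]
  refine le_antisymm (nonpos_of_forall_nsmul_le (c := 1) fun n => ?_) (le_inf hu.1 ht)
  calc n • (u ⊓ t) ≤ (n • t) ⊓ ((n • u - 1)⁺ + 1) :=
        le_inf (nsmul_le_nsmul_right inf_le_right n)
          ((nsmul_le_nsmul_right inf_le_left n).trans (sub_le_iff_le_add.1 (le_posPart _)))
    _ ≤ (n • t) ⊓ (n • u - 1)⁺ + (n • t) ⊓ 1 :=
        inf_add_le_add_inf (nsmul_nonneg ht n) (posPart_nonneg _) zero_le_one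
    _ ≤ 0 + 1 := add_le_add (IsFRing.nsmul_inf_eq_zero (h n) n).le inf_le_right
    _ = 1 := zero_add 1

theorem IsWeakOrderUnit.le_of_forall_sub_le (hu : IsWeakOrderUnit u)
    (h : ∀ n, x - y ≤ 1 - levelComponent u n) : x ≤ y := by
  refine sub_nonpos.1 (posPart_eq_zero.1 (hu.eq_zero_of_forall_inf_eq_zero (posPart_nonneg _)
    fun n => ?_))
  have hn : 0 ≤ 1 - levelComponent u n := sub_nonneg.2 (unitComponent_le_one _)
  rw [inf_comm]
  exact inf_eq_zero_of_le (inf_one_sub_unitComponent (posPart_nonneg _)) (posPart_nonneg _)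
    (posPart_nonneg _) le_rfl (sup_le (h n) hn)

end WeakOrderUnits

section OrderLL

variable {A : Type*} [ConditionallyCompleteLattice A] [Ring A] [IsOrderedAddMonoid A] {x y : A}

theorem OrderLL.le (h : OrderLL x y) : x ≤ y := by
  refine sub_nonneg.1 (negPart_eq_zero.1 (h.2 _ ?_))
  rw [abs_of_nonneg (negPart_nonneg _)]
  exact posPart_inf_negPart_eq_zero _

theorem OrderLL.isWeakOrderUnit_sub (h : OrderLL x y) : IsWeakOrderUnit (y - x) := by
  simpa only [OrderLL, sup_of_le_left (sub_nonneg.2 h.le)] using h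

end OrderLL

theorem isUnit_of_bddAbove_geom_sum {A : Type*} [ConditionallyCompleteLattice A] [Ring A]
    [IsOrderedRing A] {w : A} (hw : 0 ≤ w) (hw1 : w ≤ 1)
    (hb : BddAbove (Set.range fun N => ∑ i ∈ Finset.range N, w ^ i)) : IsUnit (1 - w) := by
  set s := fun N => ∑ i ∈ Finset.range N, w ^ i
  have hs : Monotone s := monotone_nat_of_le_succ fun N => by
    simpa only [s, Finset.sum_range_succ] using le_add_of_nonneg_right (pow_nonneg hw N)
  have hu0 : 0 ≤ 1 - w := sub_nonneg.2 hw1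
  have hu1 : 1 - w ≤ 1 := sub_le_self _ hw
  set v := ⨆ N, s N
  have hrest (N : ℕ) : 0 ≤ v - s N := sub_nonneg.2 (le_ciSup hb N)
  have hpow (N : ℕ) : w ^ N ≤ v - s N := by
    rw [le_sub_iff_add_le, add_comm, ← Finset.sum_range_succ]
    exact le_ciSup hb (N + 1)
  have abs_sub_le {r y : A} {N : ℕ} (hr : 0 ≤ r) (hrN : r ≤ v - s N) (hy : y - 1 = r - w ^ N) :
      |y - 1| ≤ v - s N := by
    rw [hy, abs_le']
    exact ⟨(sub_le_self _ (pow_nonneg hw N)).trans hrN, by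
      rw [neg_sub]; exact (sub_le_self _ hr).trans (hpow N)⟩
  have hdecr := DecreasesToZero.ciSup_sub hs hb
  refine isUnit_iff_exists.2 ⟨v, ?_, ?_⟩
  · refine hdecr.eq_of_forall_abs_sub_le fun N => abs_sub_le (mul_nonneg hu0 (hrest N))
      (mul_le_of_le_one_left (hrest N) hu1) ?_
    rw [mul_sub, mul_neg_geom_sum]
    abel
  · refine hdecr.eq_of_forall_abs_sub_le fun N => abs_sub_le (mul_nonneg (hrest N) hu0)
      (mul_le_of_le_one_right (hrest N) hu1) ?_
    rw [sub_mul, geom_sum_mul_neg]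
    abel

section LateralCompleteness

variable {A : Type*} [ConditionallyCompleteLattice A] [Ring A] [Algebra ℝ A]
  [UnivCompletePhiAlgebra A] {u : A}

theorem UnivCompletePhiAlgebra.exists_isLUB_range {x : ℕ → A} (hx : ∀ n, 0 ≤ x n)
    (hdisj : ∀ ⦃m n⦄, m < n → x m ⊓ x n = 0) : ∃ b, IsLUB (Set.range x) b := by
  refine laterally_complete _ (Set.range_nonempty x) (Set.forall_mem_range.2 hx) ?_
  rintro _ ⟨m, rfl⟩ _ ⟨n, rfl⟩ hmn
  obtain h | rfl | h := lt_trichotomy m n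
  · exact hdisj h
  · exact absurd rfl hmn
  · rw [inf_comm, hdisj h]

theorem IsWeakOrderUnit.exists_one_le_mul (hu : IsWeakOrderUnit u) : ∃ b, 0 ≤ b ∧ 1 ≤ u * b := by
  let d (n : ℕ) := levelComponent u (n + 1) - levelComponent u n
  have hd (n : ℕ) : 0 ≤ d n := sub_nonneg.2 (levelComponent_mono hu.1 n.le_succ)
  have hd_inf ⦃m n : ℕ⦄ (hmn : m < n) : ((m + 1) • d m) ⊓ ((n + 1) • d n) = 0 := by
    refine IsFRing.nsmul_inf_eq_zero ?_ _
    rw [inf_comm]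
    refine IsFRing.nsmul_inf_eq_zero ?_ _
    rw [inf_comm]
    exact levelComponent_sub_inf_levelComponent_sub hu.1 hmn
  obtain ⟨b, hb⟩ := UnivCompletePhiAlgebra.exists_isLUB_range
    (fun n => nsmul_nonneg (hd n) (n + 1)) hd_inf
  have hdb (n : ℕ) : (n + 1) • d n ≤ b := hb.1 ⟨n, rfl⟩
  have hb0 : 0 ≤ b := (nsmul_nonneg (hd 0) _).trans (hdb 0)
  have hd_le (n : ℕ) : d n ≤ u * b := by
    calc d n ≤ (n + 1) • u * d n := le_nsmul_mul_of_le_levelComponent (hd n)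
          (sub_le_self _ (unitComponent_nonneg _))
      _ = u * ((n + 1) • d n) := by rw [smul_mul_assoc, mul_smul_comm]
      _ ≤ u * b := mul_le_mul_of_nonneg_left (hdb n) hu.1
  have hlevel (n : ℕ) : levelComponent u n ≤ u * b := by
    induction n with
    | zero => exact (levelComponent_zero u).trans_le (mul_nonneg hu.1 hb0)
    | succ n ih =>
      have hinf : levelComponent u n ⊓ d n = 0 :=
        inf_eq_zero_of_le (levelComponent_inf_one_sub u n) (unitComponent_nonneg _) (hd n) le_rfl
          (sub_le_sub_right (unitComponent_le_one _) _)
      calc levelComponent u (n + 1) = levelComponent u n + d n := (add_sub_cancel _ _).symm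
        _ = levelComponent u n ⊔ d n := (sup_eq_add_of_inf_eq_zero hinf).symm
        _ ≤ u * b := sup_le ih (hd_le n)
  exact ⟨b, hb0, hu.le_of_forall_sub_le fun n => sub_le_sub_left (hlevel n) 1⟩

theorem IsWeakOrderUnit.isUnit_of_le_one (hu : IsWeakOrderUnit u) (hu1 : u ≤ 1) : IsUnit u := by
  obtain ⟨b, hb0, hb⟩ := hu.exists_one_le_mul
  have hw : 0 ≤ 1 - u := sub_nonneg.2 hu1
  rw [← sub_sub_cancel 1 u]
  refine isUnit_of_bddAbove_geom_sum hw (sub_le_self _ hu.1)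
    ⟨b, Set.forall_mem_range.2 fun N => ?_⟩
  have hs : 0 ≤ ∑ i ∈ Finset.range N, (1 - u) ^ i := Finset.sum_nonneg fun i _ => pow_nonneg hw i
  have hsu : (∑ i ∈ Finset.range N, (1 - u) ^ i) * u ≤ 1 := by
    have h := geom_sum_mul_neg (1 - u) N
    rw [sub_sub_cancel] at h
    exact h.trans_le (sub_le_self _ (pow_nonneg hw N))
  calc ∑ i ∈ Finset.range N, (1 - u) ^ i
      ≤ (∑ i ∈ Finset.range N, (1 - u) ^ i) * (u * b) := le_mul_of_one_le_right hs hb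
    _ = (∑ i ∈ Finset.range N, (1 - u) ^ i) * u * b := (mul_assoc _ _ _).symm
    _ ≤ b := mul_le_of_le_one_left hb0 hsu

end LateralCompleteness

/-! ### The theorem of Abel -/

open VLComplexification in
theorem proposition3p12_general {A : Type*} [ConditionallyCompleteLattice A] [Ring A] [Algebra ℝ A]
    [IsFRing A]
    (a : ℕ → VLComplexification A)
    (hsum : ∃ s : VLComplexification A, HasOrderSum a s)
    (z : ℕ → VLComplexification A)
    (hz : OrderTendsto z 1)
    (hz_le : ∀ k, (z k).modulus ≤ 1)
    (hz_unit : ∀ k, IsUnit (1 - (z k).modulus))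
    (hz_bdd : OrderBounded
      (Set.range fun k => (1 - z k).modulus * Ring.inverse (1 - (z k).modulus))) :
    ∃ (S : ℕ → VLComplexification A) (S_e : VLComplexification A),
      (∀ k, HasOrderSum (fun n => a n * z k ^ n) (S k)) ∧
      HasOrderSum (fun n => a n * 1 ^ n) S_e ∧
      OrderTendsto S S_e := by
  obtain ⟨s, hs⟩ := hsum
  choose S hS using fun k => hs.exists_hasOrderSum_mul_pow (hz_le k) (hz_unit k)
  refine ⟨S, s, hS, by simpa only [one_pow, mul_one] using hs, ?_⟩
  obtain ⟨p, hp, hps⟩ := hs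
  obtain ⟨q, hq, hqz⟩ := hz
  obtain ⟨_, M, hM⟩ := hz_bdd
  have hM_le (k : ℕ) := (hM ⟨k, rfl⟩).2
  have hM0 : 0 ≤ M := (mul_nonneg (modulus_nonneg (1 - z 0))
    (IsFRing.inverse_nonneg (sub_nonneg.2 (hz_le 0)))).trans (hM_le 0)
  refine orderTendsto_of_modulus_le (hq.const_mul (hp.nonneg 0)) (hp.mul_const hM0) fun k m => ?_
  refine ((hS k).modulus_sub_le hp hps (hz_le k) (hz_unit k) m).trans (add_le_add ?_ ?_)
  · rw [modulus_sub_comm]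
    exact nsmul_le_nsmul_right (mul_le_mul_of_nonneg_left (hqz k) (hp.nonneg 0)) m
  · exact mul_le_mul_of_nonneg_left (hM_le k) (hp.nonneg m)

theorem proposition3p12 {A : Type*} [ConditionallyCompleteLattice A] [Ring A] [Algebra ℝ A]
    [UnivCompletePhiAlgebra A]
    (a : ℕ → VLComplexification A)
    (hradius : IsRadiusOfConvergence a (1 : A))
    (hsum : ∃ s : VLComplexification A, HasOrderSum a s)
    (z : ℕ → VLComplexification A)
    (hz : OrderTendsto z 1)
    (hz_lt : ∀ k, OrderLL (z k).modulus (1 : A))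
    (hz_bdd : OrderBounded
      (Set.range fun k => (1 - z k).modulus * Ring.inverse (1 - (z k).modulus))) :
    ∃ (S : ℕ → VLComplexification A) (S_e : VLComplexification A),
      (∀ k, HasOrderSum (fun n => a n * z k ^ n) (S k)) ∧
      HasOrderSum (fun n => a n * 1 ^ n) S_e ∧
      OrderTendsto S S_e := by
  exact proposition3p12_general a hsum z hz (fun k => (hz_lt k).le)
    (fun k => (hz_lt k).isWeakOrderUnit_sub.isUnit_of_le_one (sub_le_self _ (z k).modulus_nonneg))
    hz_bdd
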